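/- Let $n\ge 0$, let $\omega,x_1,\dots,x_n$ be indeterminates, and work in the field $\mathbb Z[\omega](x)$ of ratios of polynomials in $x_1,\dots,x_n$ with coefficients in $\mathbb Z[\omega]$. Put $\lambda_\alpha=x_\alpha+1/x_\alpha$, $\Lambda_n=\prod_{\alpha=1}^n\lambda_\alpha$, and $$s_{\alpha\beta}=-\frac{\lambda_\alpha\lambda_\beta-\omega x_\beta/x_\alpha}{\lambda_\alpha\lambda_\beta-\omega x_\alpha/x_\beta}.$$ For $\sigma\in S_n$ and $y\in\mathbb Z^n$ let $x_\sigma^{y}=\prod_{\alpha=1}^n x_{\sigma(\alpha)}^{y_\alpha}$ and $$A_\sigma=\prod_{\substack{\alpha<\beta\\ \sigma^{-1}(\alpha)>\sigma^{-1}(\beta)}}s_{\alpha\beta},\qquad \psi(y;t)=\Lambda_n^t\sum_{\sigma\in S_n}A_\sigma x_\sigma^{y}\quad(t\in\mathbb Z_{\ge0}).$$ Let $M$ be any matching of the linear graph $1-2-\cdots-n$, with edge set $\mathcal E_M$. Put $v_i^M=\{-1\}$ if $i$ is the smaller endpoint of an edge of $M$, $v_i^M=\{+1\}$ if $i$ is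 the larger endpoint of an edge of $M$, and $v_i^M=\{+1,-1\}$ if $i$ is isolated in $M$. Then the denominators $\lambda_\alpha\lambda_\beta-\omega x_\alpha/x_\beta$ are nonzero; multiplying numerator and denominator by $x_\alpha x_\beta$ gives $$s_{\alpha\beta}=-\frac{(1+x_\alpha^2)(1+x_\beta^2)-\omega x_\beta^2}{(1+x_\alpha^2)(1+x_\beta^2)-\omega x_\alpha^2}$$ with nonzero polynomial denominator. Moreover, for every matching $M$ and every $y\in\mathbb Z^n$ with $y_i=y_{i+1}$ for each edge $\{i,i+1\}\in\mathcal E_M$ ($y$ being otherwise arbitrary), $$\sum_{\sigma\in S_n}A_\sigma\Bigl(\Lambda_n-\omega^{|\mathcal E_M|}\sum_{e_1\in v_1^M}\cdots\sum_{e_n\in v_n^M}x_\sigma^{e}\Bigr)x_\sigma^{y}=0,$$ and $\psi$ satisfies the osculation-constraint difference equations $$\psi(y;t+1)=\omega^{|\mathcal E_M|}\sum_{e_1\in v_1^M}\cdots\sum_{e_n\in v_n^M}\psi(y+e;t)\qquad\text{for all integers }t\ge0.$$ -/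

import Mathlib

namespace Osculating

/-- The inversion set `{(α, β) : α < β and σ α > σ β}` of a permutation. -/
def inversions {n : ℕ} (σ : Equiv.Perm (Fin n)) : Finset (Fin n × Fin n) :=
  Finset.univ.filter fun p => p.1 < p.2 ∧ σ p.2 < σ p.1

/-- The polynomial ring `ℤ[ω][x₁, …, xₙ]`. -/
abbrev PolyRing (n : ℕ) : Type := MvPolynomial (Fin n) (Polynomial ℤ)

/-- The field `ℤ[ω](x)` of ratios of elements of `ℤ[ω][x₁, …, xₙ]`. -/
abbrev RatField (n : ℕ) : Type := FractionRing (PolyRing n)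

/-- The indeterminate `ω` as a polynomial. -/
noncomputable def omegaPoly (n : ℕ) : PolyRing n := MvPolynomial.C Polynomial.X

/-- The indeterminate `ω` as a rational function. -/
noncomputable def omega (n : ℕ) : RatField n := algebraMap (PolyRing n) (RatField n) (omegaPoly n)

/-- The indeterminates `x₁, …, xₙ` as rational functions. -/
noncomputable def var {n : ℕ} (α : Fin n) : RatField n :=
  algebraMap (PolyRing n) (RatField n) (MvPolynomial.X α)

/-- `λ_α = x_α + 1 / x_α`. -/
noncomputable def lam {n : ℕ} (α : Fin n) : RatField n := var α + (var α)⁻¹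

/-- `Λₙ = ∏ λ_α`. -/
noncomputable def Lam (n : ℕ) : RatField n := ∏ α : Fin n, lam α

/-- `λ_α λ_β - ω x_α / x_β`, the denominator of `s_{αβ}`; its numerator is the same expression
with `α` and `β` exchanged. -/
noncomputable def scatDen {n : ℕ} (α β : Fin n) : RatField n :=
  lam α * lam β - omega n * (var α / var β)

/-- `s_{αβ} = - (λ_α λ_β - ω x_β / x_α) / (λ_α λ_β - ω x_α / x_β)`. -/
noncomputable def scat {n : ℕ} (α β : Fin n) : RatField n :=
  - ((lam α * lam β - omega n * (var β / var α)) / scatDen α β)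

/-- `(1 + x_α²)(1 + x_β²) - ω x_α²`, that is, `scatDen α β` multiplied by `x_α x_β`. -/
noncomputable def scatPoly {n : ℕ} (α β : Fin n) : PolyRing n :=
  (1 + MvPolynomial.X α ^ 2) * (1 + MvPolynomial.X β ^ 2) - omegaPoly n * MvPolynomial.X α ^ 2

/-- The amplitude `A_σ`: the product of `s_{αβ}` over the inversions of `σ`, an inversion being
recorded as the pair of values `α < β` that occur in the word `σ(1) … σ(n)` in the wrong order,
i.e. `σ⁻¹ α > σ⁻¹ β`. -/
noncomputable def amplitude {n : ℕ} (σ : Equiv.Perm (Fin n)) : RatField n :=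
  ∏ p ∈ inversions σ⁻¹, scat p.1 p.2

/-- `x_σ^y = ∏ x_{σ(α)}^{y_α}`. -/
noncomputable def monom {n : ℕ} (σ : Equiv.Perm (Fin n)) (y : Fin n → ℤ) : RatField n :=
  ∏ α : Fin n, var (σ α) ^ y α

/-- `ψ(y; t) = Λₙ^t ∑_σ A_σ x_σ^y`. -/
noncomputable def psi {n : ℕ} (y : Fin n → ℤ) (t : ℕ) : RatField n :=
  Lam n ^ t * ∑ σ : Equiv.Perm (Fin n), amplitude σ * monom σ y

open Classical in
/-- The set `v_i^M` of admissible steps at the vertex `i`: `{-1}` if `i` is the lower vertex of an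
edge of `M`, `{1}` if it is the upper vertex of an edge, `{1, -1}` if it is isolated in `M`. -/
noncomputable def steps {n : ℕ} (M : (SimpleGraph.pathGraph n).Subgraph) (i : Fin n) : Finset ℤ :=
  if ∃ j, M.Adj i j ∧ i < j then {-1}
  else if ∃ j, M.Adj i j ∧ j < i then {1}
  else {1, -1}

/-- The step vectors `(e₁, …, eₙ)` with `e_i ∈ v_i^M`. -/
noncomputable def stepVectors {n : ℕ} (M : (SimpleGraph.pathGraph n).Subgraph) :
    Finset (Fin n → ℤ) :=
  Fintype.piFinset (steps M)

end Osculating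

namespace Osculating

/-! Summing over `e` factorises over vertices: an edge `{i, i+1}` gives `x_{σ(i+1)} / x_{σ(i)}`, an
isolated vertex gives `λ_{σ(i)}`. So the bracket is the isolated `λ`'s times a difference of two
products over edges, of `λλ` and of `ω x_{σ(i+1)} / x_{σ(i)}`. Telescoping writes it as a sum of
terms, each carrying one factor `scatDen (σ (i+1)) (σ i)` and otherwise unchanged when positions `i,
i+1` are exchanged (`sum_amplitude_mul_prod_sub_prod`). Such a term cancels between `σ` and `σ *
swap i (i+1)`, because the two amplitudes differ by one scattering factor (`amplitude_pair_cancel`).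
The equation for `ψ` follows by linearity. -/

theorem var_ne_zero {n : ℕ} (α : Fin n) : (var α : RatField n) ≠ 0 := by
  unfold var
  rw [Ne, IsFractionRing.to_map_eq_zero_iff]
  exact MvPolynomial.X_ne_zero α

/-- The constant coefficient is 1. -/
theorem scatPoly_ne_zero {n : ℕ} (α β : Fin n) : scatPoly α β ≠ 0 := by
  intro h
  have := congrArg MvPolynomial.constantCoeff h
  simp [scatPoly] at this

/-- Clearing the inverses in `λ_α λ_β - ω x_α / x_β`, over an arbitrary field. -/
theorem clear_denominators {K : Type*} [Field K] {a b : K} (ha : a ≠ 0) (hb : b ≠ 0) (w : K) :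
    (a + a⁻¹) * (b + b⁻¹) - w * (a / b) =
      ((1 + a ^ 2) * (1 + b ^ 2) - w * a ^ 2) / (a * b) := by
  field_simp
  ring

theorem scatDen_eq {n : ℕ} (α β : Fin n) :
    scatDen α β = algebraMap (PolyRing n) (RatField n) (scatPoly α β) / (var α * var β) := by
  have h : algebraMap (PolyRing n) (RatField n) (scatPoly α β) =
      (1 + var α ^ 2) * (1 + var β ^ 2) - omega n * var α ^ 2 := by
    simp only [scatPoly, map_sub, map_mul, map_add, map_one, map_pow, var, omega]
  rw [h]
  exact clear_denominators (var_ne_zero α) (var_ne_zero β) (omega n)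

theorem scatDen_ne_zero {n : ℕ} (α β : Fin n) : scatDen α β ≠ 0 := by
  rw [scatDen_eq]
  refine div_ne_zero ?_ (mul_ne_zero (var_ne_zero α) (var_ne_zero β))
  rw [Ne, IsFractionRing.to_map_eq_zero_iff]
  exact scatPoly_ne_zero α β

theorem scat_eq_neg_div {n : ℕ} (α β : Fin n) :
    scat α β = -(scatDen β α / scatDen α β) := by
  simp only [scat, scatDen, mul_comm (lam β) (lam α)]

theorem scat_eq {n : ℕ} (α β : Fin n) :
    scat α β = - (algebraMap (PolyRing n) (RatField n) (scatPoly β α) /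
      algebraMap (PolyRing n) (RatField n) (scatPoly α β)) := by
  rw [scat_eq_neg_div, scatDen_eq, scatDen_eq, mul_comm (var β) (var α),
    div_div_div_cancel_right₀ (mul_ne_zero (var_ne_zero α) (var_ne_zero β))]

theorem scat_mul_scatDen {n : ℕ} (α β : Fin n) :
    scat α β * scatDen α β = - scatDen β α := by
  rw [scat_eq_neg_div, neg_mul, div_mul_cancel₀ _ (scatDen_ne_zero α β)]

/-! ### Amplitudes under adjacent transpositions -/

theorem inversions_mul_swap {n : ℕ} (σ : Equiv.Perm (Fin n)) {i j : Fin n}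
    (hij : (i : ℕ) + 1 = j) (h : σ i < σ j) :
    inversions (σ * Equiv.swap i j)⁻¹ = insert (σ i, σ j) (inversions σ⁻¹) := by
  ext ⟨α, β⟩
  obtain ⟨a, rfl⟩ := σ.surjective α
  obtain ⟨b, rfl⟩ := σ.surjective β
  simp only [inversions, Finset.mem_filter, Finset.mem_univ, true_and, mul_inv_rev,
    Equiv.swap_inv, Equiv.Perm.mul_apply, Equiv.Perm.coe_inv, Equiv.symm_apply_apply, Finset.mem_insert,
    Prod.mk.injEq, EmbeddingLike.apply_eq_iff_eq]
  -- Read on positions `a, b`: no position lies strictly between `i` and `j`, so the swap reverses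
  -- the order of no other pair.
  have key : σ a < σ b → (Equiv.swap i j b < Equiv.swap i j a ↔ (a = i ∧ b = j) ∨ b < a) := by
    intro hab
    have hne : ¬ (a = j ∧ b = i) := by
      rintro ⟨rfl, rfl⟩
      exact lt_asymm h hab
    rw [Equiv.swap_apply_def, Equiv.swap_apply_def]
    simp only [Fin.ext_iff, Fin.lt_def] at *
    split_ifs <;> omega
  constructor
  · rintro ⟨h1, h2⟩
    exact ((key h1).1 h2).imp_right fun h3 => ⟨h1, h3⟩
  · rintro (⟨rfl, rfl⟩ | ⟨h1, h2⟩)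
    · exact ⟨h, (key h).2 (Or.inl ⟨rfl, rfl⟩)⟩
    · exact ⟨h1, (key h1).2 (Or.inr h2)⟩

theorem amplitude_mul_swap {n : ℕ} (σ : Equiv.Perm (Fin n)) {i j : Fin n}
    (hij : (i : ℕ) + 1 = j) (h : σ i < σ j) :
    amplitude (σ * Equiv.swap i j) = scat (σ i) (σ j) * amplitude σ := by
  unfold amplitude
  rw [inversions_mul_swap σ hij h, Finset.prod_insert]
  simp only [inversions, Finset.mem_filter, Equiv.Perm.coe_inv, Equiv.symm_apply_apply, Fin.lt_def]
  omega

theorem amplitude_pair_cancel {n : ℕ} (σ : Equiv.Perm (Fin n)) {i j : Fin n}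
    (hij : (i : ℕ) + 1 = j) :
    amplitude σ * scatDen (σ j) (σ i) +
      amplitude (σ * Equiv.swap i j) * scatDen (σ i) (σ j) = 0 := by
  have main : ∀ τ : Equiv.Perm (Fin n), τ i < τ j →
      amplitude τ * scatDen (τ j) (τ i) +
        amplitude (τ * Equiv.swap i j) * scatDen (τ i) (τ j) = 0 := by
    intro τ h
    rw [amplitude_mul_swap τ hij h, mul_right_comm, scat_mul_scatDen, neg_mul,
      mul_comm (scatDen (τ j) (τ i)), add_neg_cancel]
  have hne : i ≠ j := fun h => by rw [h] at hij; omega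
  rcases lt_or_gt_of_ne (σ.injective.ne hne) with h | h
  · exact main σ h
  -- At a descent, the swapped permutation has an ascent, and its identity is the same with the two
  -- summands exchanged.
  · have := main (σ * Equiv.swap i j) (by simpa using h)
    rw [mul_assoc, Equiv.swap_mul_self, mul_one] at this
    simp only [Equiv.Perm.mul_apply, Equiv.swap_apply_left, Equiv.swap_apply_right] at this
    rw [add_comm]
    exact this

/-- Right multiplication by the swap is a fixed-point-free involution whose orbits sum to zero. -/
theorem sum_amplitude_mul_scatDen {n : ℕ} {i j : Fin n} (hij : (i : ℕ) + 1 = j)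
    (d : Equiv.Perm (Fin n) → RatField n) (hd : ∀ σ, d (σ * Equiv.swap i j) = d σ) :
    ∑ σ, amplitude σ * scatDen (σ j) (σ i) * d σ = 0 := by
  have hne : i ≠ j := fun h => by rw [h] at hij; omega
  refine Finset.sum_involution (fun σ _ => σ * Equiv.swap i j) ?_ ?_ ?_ ?_
  · intro σ _
    simp only [hd, Equiv.Perm.mul_apply, Equiv.swap_apply_left, Equiv.swap_apply_right]
    rw [← add_mul, amplitude_pair_cancel σ hij, zero_mul]
  · intro σ _ _ h
    rw [mul_eq_left, Equiv.swap_eq_one_iff] at h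
    exact hne h
  · intro σ _
    exact Finset.mem_univ _
  · intro σ _
    rw [mul_assoc, Equiv.swap_mul_self, mul_one]

/-- Telescoping over a family of disjoint adjacent pairs `(i, u i)`. -/
theorem sum_amplitude_mul_prod_sub_prod {n : ℕ} (u : Fin n → Fin n) (S : Finset (Fin n))
    (hu : ∀ i ∈ S, (i : ℕ) + 1 = u i) (hdisj : ∀ i ∈ S, u i ∉ S)
    (c : Equiv.Perm (Fin n) → RatField n)
    (hc : ∀ i ∈ S, ∀ σ, c (σ * Equiv.swap i (u i)) = c σ) :
    ∑ σ : Equiv.Perm (Fin n), amplitude σ *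
      ((∏ i ∈ S, lam (σ (u i)) * lam (σ i)) -
        ∏ i ∈ S, omega n * (var (σ (u i)) / var (σ i))) * c σ = 0 := by
  induction S using Finset.induction_on generalizing c with
  | empty => simp
  | insert i S hi ih =>
    have hmem : ∀ j ∈ S, j ∈ insert i S := fun j hj => Finset.mem_insert_of_mem hj
    have hii := Finset.mem_insert_self i S
    -- Disjointness of the pairs: the swap of one fixes both members of another.
    have fix : ∀ j ∈ insert i S, ∀ k ∈ insert i S, j ≠ k →
        Equiv.swap k (u k) j = j ∧ Equiv.swap k (u k) (u j) = u j := by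
      intro j hj k hk hjk
      have h1 := hu j hj
      have h2 := hu k hk
      refine ⟨Equiv.swap_apply_of_ne_of_ne hjk fun h => hdisj k hk (h ▸ hj),
        Equiv.swap_apply_of_ne_of_ne (fun h => hdisj j hj (h.symm ▸ hk)) fun h => ?_⟩
      rw [h] at h1
      exact hjk (Fin.ext (by omega))
    -- Telescoping `PQ - pq = (P - p)Q + p(Q - q)`: `e1` kills the first term, and `e2` the second,
    -- with `p` absorbed into `c`.
    have e1 := sum_amplitude_mul_scatDen (hu i hii)
      (fun σ => (∏ j ∈ S, lam (σ (u j)) * lam (σ j)) * c σ) (by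
        intro σ
        rw [hc i hii σ]
        congr 1
        refine Finset.prod_congr rfl fun j hj => ?_
        obtain ⟨f1, f2⟩ := fix j (hmem j hj) i hii (fun h => hi (h ▸ hj))
        rw [Equiv.Perm.mul_apply, Equiv.Perm.mul_apply, f1, f2])
    have e2 := ih (fun j hj => hu j (hmem j hj)) (fun j hj h => hdisj j (hmem j hj) (hmem _ h))
      (fun σ => omega n * (var (σ (u i)) / var (σ i)) * c σ) (by
        intro j hj σ
        obtain ⟨f1, f2⟩ := fix i hii j (hmem j hj) (fun h => hi (h ▸ hj))
        rw [hc j (hmem j hj) σ, Equiv.Perm.mul_apply, Equiv.Perm.mul_apply, f1, f2])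
    rw [← add_zero (0 : RatField n)]
    nth_rewrite 1 [← e1]
    rw [← e2, ← Finset.sum_add_distrib]
    refine Finset.sum_congr rfl fun σ _ => ?_
    rw [Finset.prod_insert hi, Finset.prod_insert hi, scatDen]
    ring

/-! ### Monomials and products over vertices -/

theorem monom_add {n : ℕ} (σ : Equiv.Perm (Fin n)) (y e : Fin n → ℤ) :
    monom σ (y + e) = monom σ e * monom σ y := by
  simp only [monom, Pi.add_apply]
  rw [← Finset.prod_mul_distrib]
  exact Finset.prod_congr rfl fun i _ => by rw [zpow_add₀ (var_ne_zero _), mul_comm]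

theorem monom_mul_swap {n : ℕ} (σ : Equiv.Perm (Fin n)) {y : Fin n → ℤ} {i j : Fin n}
    (h : y i = y j) : monom (σ * Equiv.swap i j) y = monom σ y := by
  unfold monom
  refine Fintype.prod_equiv (Equiv.swap i j) _ _ fun k => ?_
  rw [Equiv.Perm.mul_apply]
  congr 1
  rw [Equiv.swap_apply_def]
  split_ifs with h1 h2
  · rw [h1, h]
  · rw [h2, h]
  · rfl

/-- A product over all vertices, arranged along disjoint pairs `(i, u i)`. -/
theorem prod_eq_prod_pairs_mul {ι K : Type*} [Fintype ι] [DecidableEq ι] [CommMonoid K]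
    (u : ι → ι) (S : Finset ι) (hinj : Set.InjOn u S) (hdisj : ∀ i ∈ S, u i ∉ S) (f : ι → K) :
    ∏ i, f i = (∏ i ∈ S, f (u i) * f i) * ∏ i ∈ (S ∪ S.image u)ᶜ, f i := by
  have hd : Disjoint S (S.image u) := by
    rw [Finset.disjoint_right]
    intro a ha
    obtain ⟨i, hi, rfl⟩ := Finset.mem_image.1 ha
    exact hdisj i hi
  rw [← Finset.prod_mul_prod_compl (S ∪ S.image u), Finset.prod_union hd,
    Finset.prod_image hinj, Finset.prod_mul_distrib, mul_comm (∏ i ∈ S, f i)]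

theorem sum_stepVectors_monom {n : ℕ} (M : (SimpleGraph.pathGraph n).Subgraph)
    (σ : Equiv.Perm (Fin n)) :
    ∑ e ∈ stepVectors M, monom σ e = ∏ i, ∑ k ∈ steps M i, var (σ i) ^ k :=
  (Finset.prod_univ_sum (steps M) fun i k => var (σ i) ^ k).symm

open Classical in
/-- The lower endpoints of the edges of `M`. -/
noncomputable def lowerEnds {n : ℕ} (M : (SimpleGraph.pathGraph n).Subgraph) : Finset (Fin n) :=
  Finset.univ.filter fun i => ∃ j, M.Adj i j ∧ i < j

open Classical in
/-- The upper neighbour of a lower endpoint of an edge of `M`. -/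
noncomputable def partner {n : ℕ} (M : (SimpleGraph.pathGraph n).Subgraph) (i : Fin n) : Fin n :=
  if h : ∃ j, M.Adj i j ∧ i < j then h.choose else i

/-! ### Matchings of the path and the vanishing sum -/

section Matching

variable {n : ℕ} {M : (SimpleGraph.pathGraph n).Subgraph}

theorem val_succ_of_adj {i j : Fin n} (h : M.Adj i j) (hij : i < j) : (i : ℕ) + 1 = j := by
  have := h.adj_sub
  rw [SimpleGraph.pathGraph_adj] at this
  rw [Fin.lt_def] at hij
  omega

theorem mem_lowerEnds {i : Fin n} : i ∈ lowerEnds M ↔ ∃ j, M.Adj i j ∧ i < j := by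
  simp [lowerEnds]

theorem partner_spec {i : Fin n} (hi : i ∈ lowerEnds M) :
    M.Adj i (partner M i) ∧ i < partner M i := by
  have h := mem_lowerEnds.1 hi
  rw [partner, dif_pos h]
  exact h.choose_spec

theorem partner_eq {i j : Fin n} (h : M.Adj i j) (hij : i < j) : partner M i = j := by
  have hs := partner_spec (mem_lowerEnds.2 ⟨j, h, hij⟩)
  exact Fin.ext ((val_succ_of_adj hs.1 hs.2).symm.trans (val_succ_of_adj h hij))

theorem val_succ_eq_partner {i : Fin n} (hi : i ∈ lowerEnds M) : (i : ℕ) + 1 = partner M i :=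
  val_succ_of_adj (partner_spec hi).1 (partner_spec hi).2

theorem partner_injOn : Set.InjOn (partner M) (lowerEnds M) := by
  intro i hi j hj h
  have h1 := val_succ_eq_partner (Finset.mem_coe.1 hi)
  have h2 := val_succ_eq_partner (Finset.mem_coe.1 hj)
  rw [h] at h1
  exact Fin.ext (by omega)

theorem mem_image_partner {j : Fin n} :
    j ∈ (lowerEnds M).image (partner M) ↔ ∃ i, M.Adj j i ∧ i < j := by
  rw [Finset.mem_image]
  constructor
  · rintro ⟨i, hi, rfl⟩
    exact ⟨i, (partner_spec hi).1.symm, (partner_spec hi).2⟩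
  · rintro ⟨i, h, hij⟩
    exact ⟨i, mem_lowerEnds.2 ⟨j, h.symm, hij⟩, partner_eq h.symm hij⟩

theorem partner_notMem_lowerEnds (hM : M.IsMatching) {i : Fin n} (hi : i ∈ lowerEnds M) :
    partner M i ∉ lowerEnds M := by
  intro h
  obtain ⟨j, hj, hlt⟩ := mem_lowerEnds.1 h
  have hp := partner_spec hi
  have := hM.eq_of_adj_left hj hp.1.symm
  exact lt_asymm hp.2 (this ▸ hlt)

/-- In a path the lower endpoint determines the edge, so no matching hypothesis is needed. -/
theorem ncard_edgeSet_eq : M.edgeSet.ncard = (lowerEnds M).card := by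
  have hE : M.edgeSet = (fun i => s(i, partner M i)) '' (lowerEnds M : Set (Fin n)) := by
    ext e
    induction e using Sym2.ind with
    | _ a b =>
      rw [SimpleGraph.Subgraph.mem_edgeSet, Set.mem_image]
      constructor
      · intro h
        rcases lt_or_gt_of_ne h.adj_sub.ne with hab | hab
        · exact ⟨a, mem_lowerEnds.2 ⟨b, h, hab⟩, by rw [partner_eq h hab]⟩
        · exact ⟨b, mem_lowerEnds.2 ⟨a, h.symm, hab⟩, by
            rw [partner_eq h.symm hab, Sym2.eq_swap]⟩
      · rintro ⟨i, hi, he⟩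
        have h := (partner_spec (Finset.mem_coe.1 hi)).1
        rwa [← SimpleGraph.Subgraph.mem_edgeSet, he] at h
  rw [hE, Set.InjOn.ncard_image, Set.ncard_coe_finset]
  intro i hi j hj h
  have h1 := (partner_spec (Finset.mem_coe.1 hi)).2
  have h2 := (partner_spec (Finset.mem_coe.1 hj)).2
  rcases Sym2.eq_iff.1 h with h | h
  · exact h.1
  · rw [h.2] at h1
    rw [← h.1] at h2
    exact absurd h1 (lt_asymm h2)

theorem omega_pow_mul_sum_stepVectors (hM : M.IsMatching) (σ : Equiv.Perm (Fin n)) :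
    omega n ^ M.edgeSet.ncard * ∑ e ∈ stepVectors M, monom σ e =
      (∏ i ∈ lowerEnds M, omega n * (var (σ (partner M i)) / var (σ i))) *
        ∏ i ∈ (lowerEnds M ∪ (lowerEnds M).image (partner M))ᶜ, lam (σ i) := by
  rw [sum_stepVectors_monom, prod_eq_prod_pairs_mul (partner M) (lowerEnds M) partner_injOn
    (fun i hi => partner_notMem_lowerEnds hM hi), ncard_edgeSet_eq,
    Finset.prod_mul_distrib (f := fun _ => omega n), Finset.prod_const, ← mul_assoc]
  congr 1
  · congr 1
    refine Finset.prod_congr rfl fun i hi => ?_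
    have h1 : steps M i = {-1} := by rw [steps, if_pos (mem_lowerEnds.1 hi)]
    have h2 : steps M (partner M i) = {1} := by
      -- The lower-endpoint test comes first in `steps`; the matching property rules it out for an
      -- upper endpoint.
      rw [steps, if_neg fun h => partner_notMem_lowerEnds hM hi (mem_lowerEnds.2 h),
        if_pos (mem_image_partner.1 (Finset.mem_image_of_mem _ hi))]
    rw [h1, h2, Finset.sum_singleton, Finset.sum_singleton, zpow_one, zpow_neg_one, div_eq_mul_inv]
  · refine Finset.prod_congr rfl fun i hi => ?_
    rw [Finset.mem_compl, Finset.mem_union, not_or, mem_lowerEnds, mem_image_partner] at hi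
    rw [steps, if_neg hi.1, if_neg hi.2, Finset.sum_pair (by decide), zpow_one, zpow_neg_one, lam]

/-- `Λₙ` is symmetric, so its factors may be reindexed by `σ` before being grouped along edges. -/
theorem Lam_eq (hM : M.IsMatching) (σ : Equiv.Perm (Fin n)) :
    Lam n = (∏ i ∈ lowerEnds M, lam (σ (partner M i)) * lam (σ i)) *
        ∏ i ∈ (lowerEnds M ∪ (lowerEnds M).image (partner M))ᶜ, lam (σ i) := by
  rw [Lam, ← Equiv.prod_comp σ]
  exact prod_eq_prod_pairs_mul (partner M) (lowerEnds M) partner_injOn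
    (fun i hi => partner_notMem_lowerEnds hM hi) fun i => lam (σ i)

theorem sum_amplitude_mul_osculation (hM : M.IsMatching) {y : Fin n → ℤ}
    (hy : ∀ i j, M.Adj i j → y i = y j) :
    ∑ σ : Equiv.Perm (Fin n), amplitude σ *
      (Lam n - omega n ^ M.edgeSet.ncard * ∑ e ∈ stepVectors M, monom σ e) * monom σ y = 0 := by
  have key := sum_amplitude_mul_prod_sub_prod (partner M) (lowerEnds M)
    (fun i hi => val_succ_eq_partner hi) (fun i hi => partner_notMem_lowerEnds hM hi)
    (fun σ => (∏ i ∈ (lowerEnds M ∪ (lowerEnds M).image (partner M))ᶜ, lam (σ i)) * monom σ y) (by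
      intro i hi σ
      rw [monom_mul_swap σ (hy i _ (partner_spec hi).1)]
      congr 1
      refine Finset.prod_congr rfl fun j hj => ?_
      rw [Finset.mem_compl, Finset.mem_union, not_or] at hj
      have h1 : j ≠ i := fun h => hj.1 (h ▸ hi)
      have h2 : j ≠ partner M i := fun h => hj.2 (h ▸ Finset.mem_image_of_mem _ hi)
      rw [Equiv.Perm.mul_apply, Equiv.swap_apply_of_ne_of_ne h1 h2])
  rw [← key]
  refine Finset.sum_congr rfl fun σ _ => ?_
  rw [omega_pow_mul_sum_stepVectors hM, Lam_eq hM σ, ← sub_mul]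
  simp only [mul_assoc]

end Matching

theorem psi_succ_of_sum_eq_zero {n : ℕ} {y : Fin n → ℤ} {w : RatField n}
    {E : Finset (Fin n → ℤ)}
    (h : ∑ σ : Equiv.Perm (Fin n), amplitude σ *
      (Lam n - w * ∑ e ∈ E, monom σ e) * monom σ y = 0) (t : ℕ) :
    psi y (t + 1) = w * ∑ e ∈ E, psi (y + e) t := by
  have hl : Lam n * ∑ σ, amplitude σ * monom σ y =
      w * ∑ e ∈ E, ∑ σ, amplitude σ * monom σ (y + e) := by
    rw [Finset.sum_comm, Finset.mul_sum, Finset.mul_sum, ← sub_eq_zero,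
      ← Finset.sum_sub_distrib, ← h]
    refine Finset.sum_congr rfl fun σ _ => ?_
    simp only [monom_add]
    rw [← Finset.mul_sum, ← Finset.sum_mul]
    ring
  simp only [psi]
  rw [← Finset.mul_sum, pow_succ, mul_assoc, hl, mul_left_comm]

end Osculating

theorem lemma1 (n : ℕ) :
    (∀ α β : Fin n, Osculating.scatDen α β ≠ 0 ∧ Osculating.scatPoly α β ≠ 0 ∧
      Osculating.scat α β =
        - (algebraMap (Osculating.PolyRing n) (Osculating.RatField n) (Osculating.scatPoly β α) /
          algebraMap (Osculating.PolyRing n) (Osculating.RatField n)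
            (Osculating.scatPoly α β))) ∧
    ∀ M : (SimpleGraph.pathGraph n).Subgraph, M.IsMatching →
      ∀ y : Fin n → ℤ, (∀ i j : Fin n, M.Adj i j → y i = y j) →
        (∑ σ : Equiv.Perm (Fin n),
          Osculating.amplitude σ *
            (Osculating.Lam n -
              Osculating.omega n ^ M.edgeSet.ncard *
                ∑ e ∈ Osculating.stepVectors M, Osculating.monom σ e) *
            Osculating.monom σ y = 0) ∧
        ∀ t : ℕ,
          Osculating.psi y (t + 1) =
            Osculating.omega n ^ M.edgeSet.ncard *
              ∑ e ∈ Osculating.stepVectors M, Osculating.psi (y + e) t := by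
  refine ⟨fun α β => ⟨Osculating.scatDen_ne_zero α β, Osculating.scatPoly_ne_zero α β,
    Osculating.scat_eq α β⟩, fun M hM y hy => ?_⟩
  have h := Osculating.sum_amplitude_mul_osculation hM hy
  exact ⟨h, Osculating.psi_succ_of_sum_eq_zero h⟩
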